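/- Let $\mathbb K$ be $\mathbb R$ or $\mathbb C$, let $T$ be an uncountable set, and let $(B_t)_{t\in T}$ be a family of Banach spaces over $\mathbb K$. For any family of locally convex spaces, the locally convex direct sum $\bigoplus$ is the space of families with finitely many non-zero members, endowed with the finest locally convex vector space topology for which all embeddings of the summands are continuous. An (LB)-space is a strict inductive limit, in the category of locally convex spaces, of a sequence of Banach spaces. A linear subspace (with the subspace topology) is complemented if there is a continuous linear projection of the whole space onto it. Let $X$ be a complemented subspace of $\bigoplus_{t\in T} B_t$. Then there are a set $J$ and, for every $j\in J$, a countably infinite subset $T_j\subseteq T$ and a complemented subspace $F_j$ of $\bigoplus_{t\in T_j} B_t$, such that every $F_j$ is an (LB)-space and $X$ is topologically isomorphic, as a topological vector space, to the locally convex direct sum $\bigoplus_{j\in J} F_j$. -/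

import Mathlib

open Topology
open scoped ComplexOrder

universe u v w

/-- The finest locally convex vector space topology on `F` for which all the linear maps
`f i : E i → F` are continuous. (In Mathlib's order on topologies, finer means smaller; local
convexity and continuity of the `f i` pass to infima, so the infimum below is attained.) -/
@[reducible]
def finestLocallyConvexTopology (𝕜 : Type*) [RCLike 𝕜] {ι : Type*} {E : ι → Type*}
    [∀ i, AddCommGroup (E i)] [∀ i, Module 𝕜 (E i)] [∀ i, TopologicalSpace (E i)]
    {F : Type*} [AddCommGroup F] [Module 𝕜 F] (f : ∀ i, E i →ₗ[𝕜] F) : TopologicalSpace F :=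
  sInf {t : TopologicalSpace F | @IsTopologicalAddGroup F t _ ∧ @ContinuousSMul 𝕜 F _ _ t ∧
    @LocallyConvexSpace 𝕜 F _ _ _ _ t ∧ ∀ i, @Continuous (E i) F _ t (f i)}

/-- The locally convex direct sum of a family of topological vector spaces over `𝕜`. As a vector
space it consists of the families with finitely many non-zero members. -/
def LCDirectSum (𝕜 : Type u) [RCLike 𝕜] {ι : Type v} (E : ι → Type w)
    [∀ i, AddCommGroup (E i)] : Type (max v w) :=
  Π₀ i, E i

namespace LCDirectSum

variable (𝕜 : Type u) [RCLike 𝕜] {ι : Type v} (E : ι → Type w) [∀ i, AddCommGroup (E i)]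

instance : AddCommGroup (LCDirectSum 𝕜 E) :=
  inferInstanceAs (AddCommGroup (Π₀ i, E i))

variable [∀ i, Module 𝕜 (E i)]

instance : Module 𝕜 (LCDirectSum 𝕜 E) :=
  inferInstanceAs (Module 𝕜 (Π₀ i, E i))

open Classical in
/-- The natural embedding of a summand into the direct sum. -/
noncomputable def incl (i : ι) : E i →ₗ[𝕜] LCDirectSum 𝕜 E :=
  (DFinsupp.lsingle i : E i →ₗ[𝕜] Π₀ i, E i)

variable [∀ i, TopologicalSpace (E i)]

noncomputable instance : TopologicalSpace (LCDirectSum 𝕜 E) :=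
  finestLocallyConvexTopology 𝕜 (incl 𝕜 E)

instance : IsTopologicalAddGroup (LCDirectSum 𝕜 E) :=
  topologicalAddGroup_sInf fun _ h ↦ h.1

instance : ContinuousSMul 𝕜 (LCDirectSum 𝕜 E) :=
  continuousSMul_sInf fun _ h ↦ h.2.1

instance : LocallyConvexSpace 𝕜 (LCDirectSum 𝕜 E) :=
  LocallyConvexSpace.sInf fun _ h ↦ h.2.2.1

end LCDirectSum

/-- A topological vector space `F` is an (LB)-space if it is the strict inductive limit of a
sequence of Banach spaces: there are Banach spaces `B 0, B 1, …`, linear topological embeddings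
`j n : B n → B (n + 1)`, and compatible injective linear maps `i n : B n → F` whose ranges cover
`F`, such that `F` has the finest locally convex topology making all `i n` continuous. -/
def IsLBSpace (𝕜 : Type u) [RCLike 𝕜] (F : Type v) [AddCommGroup F] [Module 𝕜 F]
    [tF : TopologicalSpace F] : Prop :=
  ∃ (B : ℕ → Type v) (_ : ∀ n, NormedAddCommGroup (B n)) (_ : ∀ n, NormedSpace 𝕜 (B n))
    (_ : ∀ n, CompleteSpace (B n)) (j : ∀ n, B n →L[𝕜] B (n + 1)) (i : ∀ n, B n →ₗ[𝕜] F),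
    (∀ n, IsEmbedding (j n)) ∧
    (∀ n x, i (n + 1) (j n x) = i n x) ∧
    (∀ n, Function.Injective (i n)) ∧
    (∀ y : F, ∃ n x, i n x = y) ∧
    tF = finestLocallyConvexTopology 𝕜 i

/-!
Let `P` be an idempotent with range `X`, viewed as a matrix of maps `B s → B t`. By the Baire
category theorem each column of `P` has only finitely many non-zero entries. A closing-off argument
therefore splits `T` into countably infinite blocks, indexed by a well-order `J`, with respect to
which `P` is block triangular. Its diagonal part `D` is again idempotent, and `P - D` is strictly
block triangular. Hence `U = P D + (1 - P) (1 - D) = 1 - N` with `N` strictly block triangular, and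
well-foundedness of `J` makes `U` invertible. As `P U = P D = U D`, `U` maps the range of `D`,
which is the direct sum of the ranges of the diagonal blocks, isomorphically onto `X`.
-/

section FinestLocallyConvexTopology

variable {𝕜 : Type*} [RCLike 𝕜] {ι : Type*} {E : ι → Type*}
  [∀ i, AddCommGroup (E i)] [∀ i, Module 𝕜 (E i)] [∀ i, TopologicalSpace (E i)]
  {F : Type*} [AddCommGroup F] [Module 𝕜 F]

theorem continuous_finestLocallyConvexTopology (f : ∀ i, E i →ₗ[𝕜] F) (i : ι) :
    @Continuous (E i) F _ (finestLocallyConvexTopology 𝕜 f) (f i) :=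
  continuous_sInf_rng.2 fun _ ht ↦ ht.2.2.2 i

theorem finestLocallyConvexTopology_le [tF : TopologicalSpace F] [IsTopologicalAddGroup F]
    [ContinuousSMul 𝕜 F] [LocallyConvexSpace 𝕜 F] {f : ∀ i, E i →ₗ[𝕜] F}
    (hf : ∀ i, Continuous (f i)) : finestLocallyConvexTopology 𝕜 f ≤ tF :=
  sInf_le ⟨inferInstance, inferInstance, inferInstance, hf⟩

theorem continuous_of_continuous_comp_finestLocallyConvexTopology {f : ∀ i, E i →ₗ[𝕜] F}
    {G : Type*} [AddCommGroup G] [Module 𝕜 G] [TopologicalSpace G] [IsTopologicalAddGroup G]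
    [ContinuousSMul 𝕜 G] [LocallyConvexSpace 𝕜 G] {g : F →ₗ[𝕜] G}
    (hg : ∀ i, Continuous (g ∘ₗ f i)) :
    @Continuous F G (finestLocallyConvexTopology 𝕜 f) _ g :=
  continuous_iff_le_induced.2 <| sInf_le ⟨topologicalAddGroup_induced g,
    continuousSMul_induced g, LocallyConvexSpace.induced g, fun i ↦ continuous_induced_rng.2 (hg i)⟩

theorem finestLocallyConvexTopology_le_of_factor {κ : Type*} {E' : κ → Type*}
    [∀ k, AddCommGroup (E' k)] [∀ k, Module 𝕜 (E' k)] [∀ k, TopologicalSpace (E' k)]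
    {f : ∀ i, E i →ₗ[𝕜] F} {g : ∀ k, E' k →ₗ[𝕜] F}
    (h : ∀ i, ∃ k, ∃ q : E i →L[𝕜] E' k, ∀ x, g k (q x) = f i x) :
    finestLocallyConvexTopology 𝕜 f ≤ finestLocallyConvexTopology 𝕜 g := by
  refine sInf_le_sInf fun t ⟨hadd, hsmul, hconvex, hg⟩ ↦ ⟨hadd, hsmul, hconvex, fun i ↦ ?_⟩
  obtain ⟨k, q, hq⟩ := h i
  exact ((hg k).comp q.continuous).congr hq

end FinestLocallyConvexTopology

theorem locallyConvexSpace_of_normedSpace {𝕜 : Type*} [RCLike 𝕜] {E : Type*}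
    [SeminormedAddCommGroup E] [NormedSpace 𝕜 E] : LocallyConvexSpace 𝕜 E :=
  letI : NormedSpace ℝ E := .restrictScalars ℝ 𝕜 E
  haveI : IsScalarTower ℝ 𝕜 E := .restrictScalars ℝ 𝕜 E
  .ofBases 𝕜 E _ _ (fun _ ↦ Metric.nhds_basis_ball) fun x r _ ↦
    convex_RCLike_iff_convex_real.2 (convex_ball x r)

attribute [local instance] locallyConvexSpace_of_normedSpace

section LBSpace

theorem exists_continuousLinearMap_comp_eq {R : Type*} [Semiring R] {G B F : Type*}
    [AddCommMonoid G] [Module R G] [TopologicalSpace G]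
    [AddCommMonoid B] [Module R B] [TopologicalSpace B]
    [AddCommMonoid F] [Module R F] [TopologicalSpace F]
    {i : B →L[R] F} (hi : IsEmbedding i) {g : G →L[R] F} (hg : ∀ x, g x ∈ i.range) :
    ∃ q : G →L[R] B, ∀ x, i (q x) = g x := by
  let q : G →ₗ[R] B := (LinearEquiv.ofInjective i.toLinearMap hi.injective).symm.toLinearMap ∘ₗ
    g.toLinearMap.codRestrict i.range hg
  have hq (x : G) : i (q x) = g x :=
    congrArg Subtype.val (LinearEquiv.apply_symm_apply (.ofInjective i.toLinearMap hi.injective) _)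
  exact ⟨⟨q, hi.continuous_iff.2 (g.continuous.congr fun x ↦ (hq x).symm)⟩, hq⟩

theorem isLBSpace_of_isEmbedding {𝕜 : Type u} [RCLike 𝕜] {F : Type v} [AddCommGroup F] [Module 𝕜 F]
    [tF : TopologicalSpace F] {B : ℕ → Type v} [∀ n, NormedAddCommGroup (B n)]
    [∀ n, NormedSpace 𝕜 (B n)] [∀ n, CompleteSpace (B n)] {i : ∀ n, B n →L[𝕜] F}
    (hi : ∀ n, IsEmbedding (i n)) (hmono : Monotone fun n ↦ (i n).range)
    (hcover : ∀ y, ∃ n, y ∈ (i n).range)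
    (htop : tF = finestLocallyConvexTopology 𝕜 fun n ↦ (i n : B n →ₗ[𝕜] F)) :
    IsLBSpace 𝕜 F := by
  have hsucc (n : ℕ) (x : B n) : i n x ∈ (i (n + 1)).range := hmono n.le_succ ⟨x, rfl⟩
  choose j hj using fun n ↦ exists_continuousLinearMap_comp_eq (hi (n + 1)) (hsucc n)
  have hj_embedding (n : ℕ) : IsEmbedding (j n) :=
    .of_comp (j n).continuous (i (n + 1)).continuous <|
      (funext (hj n) : i (n + 1) ∘ j n = i n) ▸ hi n
  exact ⟨B, inferInstance, inferInstance, inferInstance, j, fun n ↦ (i n : B n →ₗ[𝕜] F),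
    hj_embedding, hj, fun n ↦ (hi n).injective, hcover, htop⟩

end LBSpace

section Retract

variable {R : Type*} [Ring R] {E : Type*} [AddCommGroup E] [Module R E] [TopologicalSpace E]

theorem closedComplemented_iff_exists_isIdempotentElem {X : Submodule R E} :
    X.ClosedComplemented ↔ ∃ P : E →L[R] E, IsIdempotentElem P ∧ P.range = X := by
  constructor
  · intro hX
    obtain ⟨Y, hY⟩ := hX.exists_isTopCompl
    exact ⟨X.projectionL Y hY, Submodule.isIdempotentElem_projectionL hY, by simp⟩
  · rintro ⟨P, hP, rfl⟩
    exact (ContinuousLinearMap.IsIdempotentElem.isTopCompl hP).closedComplemented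

theorem rangeRestrict_comp_subtypeL {P : E →L[R] E} (hP : IsIdempotentElem P) :
    P.rangeRestrict.comp P.range.subtypeL = .id R P.range := by
  ext ⟨_, x, rfl⟩
  exact DFunLike.congr_fun hP x

theorem nonempty_continuousLinearEquiv_of_isUnit [IsTopologicalAddGroup E]
    {X Y : Type*} [AddCommGroup X] [Module R X]
    [TopologicalSpace X] [AddCommGroup Y] [Module R Y] [TopologicalSpace Y]
    {i : X →L[R] E} {p : E →L[R] X} (hpi : p.comp i = .id R X)
    {j : Y →L[R] E} {q : E →L[R] Y} (hqj : q.comp j = .id R Y)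
    (hU : IsUnit (i.comp p * j.comp q + (1 - i.comp p) * (1 - j.comp q))) :
    Nonempty (X ≃L[R] Y) := by
  obtain ⟨u, hu⟩ := hU
  replace hpi : ∀ x, p (i x) = x := fun x ↦ DFunLike.congr_fun hpi x
  replace hqj : ∀ y, q (j y) = y := fun y ↦ DFunLike.congr_fun hqj y
  -- With `P = i p` and `D = j q`, the unit `U` satisfies `P U = P D = U D`.
  have hpu (z : E) : p ((u : E →L[R] E) z) = p (j (q z)) := by simp [hu, hpi]
  have huj (y : Y) : (u : E →L[R] E) (j y) = i (p (j y)) := by simp [hu, hqj]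
  let v : E ≃L[R] E := ContinuousLinearEquiv.unitsEquiv R E u
  refine ⟨.equivOfInverse (q.comp ((v.symm : E →L[R] E).comp i)) (p.comp j) (fun x ↦ ?_)
    fun y ↦ ?_⟩
  · calc p (j (q (v.symm (i x)))) = p (v (v.symm (i x))) := (hpu _).symm
      _ = x := by rw [v.apply_symm_apply, hpi]
  · calc q (v.symm (i (p (j y)))) = q (v.symm (v (j y))) := by rw [← huj]; rfl
      _ = y := by rw [v.symm_apply_apply, hqj]

theorem mul_add_one_sub_mul_one_sub {A : Type*} [Ring A] {p : A} (hp : IsIdempotentElem p)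
    (d : A) : p * d + (1 - p) * (1 - d) = 1 - (p * (p - d) - (1 - p) * (p - d)) := by
  have : p * p = p := hp
  noncomm_ring
  rw [this]
  abel

end Retract

section Partition

theorem countable_setOf_reflTransGen {α : Type*} {r : α → α → Prop}
    (h : ∀ a, {b | r a b}.Countable) (a : α) : {b | Relation.ReflTransGen r a b}.Countable := by
  let S : ℕ → Set α := fun n ↦ (fun A ↦ ⋃ b ∈ A, {c | r b c})^[n] {a}
  have hS_succ (n : ℕ) : S (n + 1) = ⋃ b ∈ S n, {c | r b c} := Function.iterate_succ_apply' ..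
  have hS (n : ℕ) : (S n).Countable := by
    induction n with
    | zero => exact Set.countable_singleton a
    | succ n ih => exact hS_succ n ▸ ih.biUnion fun b _ ↦ h b
  refine (Set.countable_iUnion hS).mono fun b hb ↦ ?_
  induction hb with
  | refl => exact Set.mem_iUnion.2 ⟨0, rfl⟩
  | tail _ hbc ih =>
    obtain ⟨n, hn⟩ := Set.mem_iUnion.1 ih
    exact Set.mem_iUnion.2 ⟨n + 1, hS_succ n ▸ Set.mem_biUnion hn hbc⟩

theorem exists_antitone_map_countable_fibers {α : Type*} [LinearOrder α] [WellFoundedLT α]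
    {r : α → α → Prop} (hr : ∀ a, {b | r a b}.Countable) :
    ∃ f : α → α, (∀ a b, r a b → f b ≤ f a) ∧ ∀ c, (f ⁻¹' {c}).Countable := by
  have hne (a : α) : {c | Relation.ReflTransGen r c a}.Nonempty := ⟨a, .refl⟩
  -- `f a` is the least element from which `a` can be reached along `r`.
  let f : α → α := fun a ↦ wellFounded_lt.min _ (hne a)
  have hf (a : α) : Relation.ReflTransGen r (f a) a := wellFounded_lt.min_mem _ (hne a)
  refine ⟨f, fun a b hab ↦ wellFounded_lt.min_le (s := {c | Relation.ReflTransGen r c b})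
    ((hf a).tail hab), fun c ↦ (countable_setOf_reflTransGen hr c).mono ?_⟩
  rintro a rfl
  exact hf a

theorem exists_mk_fiber_eq_aleph0 (α : Type*) [Infinite α] :
    ∃ g : α → α, ∀ a, Cardinal.mk (g ⁻¹' {a}) = Cardinal.aleph0 := by
  obtain ⟨e⟩ : Nonempty (α ≃ α × ℕ) := by
    rw [← Cardinal.lift_mk_eq']
    simp [Cardinal.mul_aleph0_eq (Cardinal.aleph0_le_mk α)]
  refine ⟨fun t ↦ (e t).1, fun a ↦ ?_⟩
  have hrange : (fun t ↦ (e t).1) ⁻¹' {a} = Set.range fun n : ℕ ↦ e.symm (a, n) := by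
    ext t
    constructor
    · rintro rfl
      exact ⟨(e t).2, e.symm_apply_apply t⟩
    · rintro ⟨n, rfl⟩
      simp
  have hinj : Function.Injective fun n : ℕ ↦ e.symm (a, n) :=
    e.symm.injective.comp (Prod.mk_right_injective a)
  simpa [hrange] using Cardinal.mk_range_eq_of_injective hinj

theorem exists_wellFounded_partition {T : Type u} [Infinite T] {r : T → T → Prop}
    (hr : ∀ t, {s | r t s}.Countable) :
    ∃ (J : Type u) (_ : LinearOrder J) (_ : WellFoundedLT J) (f : T → J),
      (∀ t s, r t s → f s ≤ f t) ∧ ∀ j, Cardinal.mk (f ⁻¹' {j}) = Cardinal.aleph0 := by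
  obtain ⟨_, _⟩ := exists_wellFoundedLT T
  -- Collapsing countably infinite sets by `g` first keeps the blocks from being finite.
  obtain ⟨g, hg⟩ := exists_mk_fiber_eq_aleph0 T
  have hg_countable (a : T) : (g ⁻¹' {a}).Countable :=
    Cardinal.mk_le_aleph0_iff.1 (hg a).le
  have hmap (a : T) : {b | Relation.Map r g g a b}.Countable := by
    refine ((hg_countable a).biUnion fun t _ ↦ (hr t).image g).mono ?_
    rintro b ⟨t, s, hts, rfl, rfl⟩
    exact Set.mem_biUnion (x := t) rfl ⟨s, hts, rfl⟩
  obtain ⟨f, hf, hf_countable⟩ := exists_antitone_map_countable_fibers hmap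
  refine ⟨Set.range (f ∘ g), inferInstance, inferInstance, Set.rangeFactorization (f ∘ g),
    fun t s hts ↦ hf _ _ ⟨t, s, hts, rfl, rfl⟩, ?_⟩
  rintro ⟨_, t, rfl⟩
  refine le_antisymm (Cardinal.mk_le_aleph0_iff.2 ?_) ((hg (g t)).symm.trans_le ?_)
  · refine ((hf_countable (f (g t))).biUnion fun a _ ↦ hg_countable a).mono fun s hs ↦ ?_
    exact Set.mem_biUnion (x := g s) (congrArg Subtype.val hs : f (g s) = f (g t)) rfl
  · exact Cardinal.mk_le_mk_of_subset fun s (hs : g s = g t) ↦ Subtype.ext (congrArg f hs)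

end Partition

namespace LCDirectSum

section Algebra

variable {𝕜 : Type u} [RCLike 𝕜] {ι : Type v} {E : ι → Type w} [∀ i, AddCommGroup (E i)]
  [∀ i, Module 𝕜 (E i)]

variable (𝕜 E) in
/-- The coordinate maps of a direct sum. -/
def proj (i : ι) : LCDirectSum 𝕜 E →ₗ[𝕜] E i :=
  (DFinsupp.lapply i : (Π₀ i, E i) →ₗ[𝕜] E i)

@[ext]
theorem ext {x y : LCDirectSum 𝕜 E} (h : ∀ i, proj 𝕜 E i x = proj 𝕜 E i y) : x = y :=
  DFinsupp.ext h

@[simp]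
theorem proj_incl_self (i : ι) (b : E i) : proj 𝕜 E i (incl 𝕜 E i b) = b := by
  classical
  exact DFinsupp.single_eq_same (β := E)

theorem proj_incl_of_ne {i k : ι} (h : i ≠ k) (b : E k) : proj 𝕜 E i (incl 𝕜 E k b) = 0 := by
  classical
  exact DFinsupp.single_eq_of_ne (β := E) h

theorem finite_setOf_proj_ne_zero (x : LCDirectSum 𝕜 E) : {i | proj 𝕜 E i x ≠ 0}.Finite :=
  DFinsupp.finite_support (x : Π₀ i, E i)

theorem sum_incl_proj {x : LCDirectSum 𝕜 E} {s : Finset ι} (hs : ∀ i ∉ s, proj 𝕜 E i x = 0) :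
    ∑ i ∈ s, incl 𝕜 E i (proj 𝕜 E i x) = x := by
  ext i
  rw [map_sum]
  by_cases hi : i ∈ s
  · rw [Finset.sum_eq_single_of_mem i hi fun k _ hk ↦ proj_incl_of_ne hk.symm _, proj_incl_self]
  · rw [hs i hi]
    exact Finset.sum_eq_zero fun k hk ↦ proj_incl_of_ne (ne_of_mem_of_not_mem hk hi).symm _

theorem exists_sum_incl_proj (x : LCDirectSum 𝕜 E) :
    ∃ s : Finset ι, (∀ i ∈ s, proj 𝕜 E i x ≠ 0) ∧ ∑ i ∈ s, incl 𝕜 E i (proj 𝕜 E i x) = x :=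
  ⟨(finite_setOf_proj_ne_zero x).toFinset, by simp, sum_incl_proj (by simp)⟩

theorem linearMap_ext {G : Type*} [AddCommGroup G] [Module 𝕜 G] {g h : LCDirectSum 𝕜 E →ₗ[𝕜] G}
    (H : ∀ i b, g (incl 𝕜 E i b) = h (incl 𝕜 E i b)) : g = h := by
  ext x
  obtain ⟨s, -, hs⟩ := exists_sum_incl_proj x
  rw [← hs, map_sum, map_sum]
  exact Finset.sum_congr rfl fun i _ ↦ H i _

variable (𝕜 E) in
/-- The subspace of the families that vanish outside a set of indices. -/
def supportedOn (S : Set ι) : Submodule 𝕜 (LCDirectSum 𝕜 E) :=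
  ⨅ i ∈ Sᶜ, LinearMap.ker (proj 𝕜 E i)

theorem mem_supportedOn {S : Set ι} {x : LCDirectSum 𝕜 E} :
    x ∈ supportedOn 𝕜 E S ↔ ∀ i ∉ S, proj 𝕜 E i x = 0 := by
  simp [supportedOn, Submodule.mem_iInf]

theorem mem_supportedOn_iff_setOf_subset {S : Set ι} {x : LCDirectSum 𝕜 E} :
    x ∈ supportedOn 𝕜 E S ↔ {i | proj 𝕜 E i x ≠ 0} ⊆ S :=
  mem_supportedOn.trans <| forall_congr' fun _ ↦ not_imp_comm

theorem supportedOn_mono {S S' : Set ι} (h : S ⊆ S') : supportedOn 𝕜 E S ≤ supportedOn 𝕜 E S' :=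
  fun _ hx ↦ mem_supportedOn_iff_setOf_subset.2 <| (mem_supportedOn_iff_setOf_subset.1 hx).trans h

theorem incl_mem_supportedOn {S : Set ι} {i : ι} (hi : i ∈ S) (b : E i) :
    incl 𝕜 E i b ∈ supportedOn 𝕜 E S :=
  mem_supportedOn.2 fun _ hk ↦ proj_incl_of_ne (ne_of_mem_of_not_mem hi hk).symm b

theorem supportedOn_le_comap {G : Type*} [AddCommGroup G] [Module 𝕜 G] {M : Submodule 𝕜 G}
    {g : LCDirectSum 𝕜 E →ₗ[𝕜] G} {S : Set ι} (h : ∀ i ∈ S, ∀ b, g (incl 𝕜 E i b) ∈ M) :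
    supportedOn 𝕜 E S ≤ M.comap g := by
  intro x hx
  obtain ⟨s, hs, hsum⟩ := exists_sum_incl_proj x
  rw [Submodule.mem_comap, ← hsum, map_sum]
  exact M.sum_mem fun i hi ↦ h i (mem_supportedOn_iff_setOf_subset.1 hx (hs i hi)) _

end Algebra

section Topology

variable {𝕜 : Type u} [RCLike 𝕜] {ι : Type v} {E : ι → Type w} [∀ i, AddCommGroup (E i)]
  [∀ i, Module 𝕜 (E i)] [∀ i, TopologicalSpace (E i)]
  {G : Type*} [AddCommGroup G] [Module 𝕜 G] [TopologicalSpace G]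

variable (𝕜 E) in
/-- `LCDirectSum.incl` as a continuous linear map. -/
noncomputable def inclL (i : ι) : E i →L[𝕜] LCDirectSum 𝕜 E :=
  ⟨incl 𝕜 E i, continuous_finestLocallyConvexTopology _ i⟩

@[simp]
theorem inclL_apply (i : ι) (b : E i) : inclL 𝕜 E i b = incl 𝕜 E i b := rfl

theorem continuousLinearMap_ext {g h : LCDirectSum 𝕜 E →L[𝕜] G}
    (H : ∀ i b, g (incl 𝕜 E i b) = h (incl 𝕜 E i b)) : g = h :=
  ContinuousLinearMap.coe_injective (linearMap_ext H)

variable [IsTopologicalAddGroup G] [ContinuousSMul 𝕜 G] [LocallyConvexSpace 𝕜 G]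

theorem continuous_of_comp_incl {g : LCDirectSum 𝕜 E →ₗ[𝕜] G}
    (h : ∀ i, Continuous (g ∘ₗ incl 𝕜 E i)) : Continuous g :=
  continuous_of_continuous_comp_finestLocallyConvexTopology h

theorem eq_finestLocallyConvexTopology_of_retract {F : Type*} [AddCommGroup F] [Module 𝕜 F]
    [tF : TopologicalSpace F] [IsTopologicalAddGroup F] [ContinuousSMul 𝕜 F]
    [LocallyConvexSpace 𝕜 F] (p : LCDirectSum 𝕜 E →L[𝕜] F) (s : F →L[𝕜] LCDirectSum 𝕜 E)
    (hps : ∀ y, p (s y) = y) :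
    tF = finestLocallyConvexTopology 𝕜 fun i ↦ (p : LCDirectSum 𝕜 E →ₗ[𝕜] F) ∘ₗ incl 𝕜 E i := by
  have hs : Continuous s := s.continuous
  refine le_antisymm (le_sInf fun t ⟨hadd, hsmul, hconvex, ht⟩ ↦ ?_)
    (finestLocallyConvexTopology_le fun i ↦ p.continuous.comp (inclL 𝕜 E i).continuous)
  have hp : @Continuous _ F _ t p :=
    @continuous_of_comp_incl _ _ _ _ _ _ _ F _ _ t hadd hsmul hconvex
      (p : LCDirectSum 𝕜 E →ₗ[𝕜] F) ht
  have hid : @Continuous _ _ tF t (p ∘ s) := @Continuous.comp _ _ _ tF _ t _ _ hp hs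
  exact continuous_id_iff_le.1 ((funext hps : p ∘ s = id) ▸ hid)

open Classical in
/-- The continuous linear map on a direct sum with given restrictions to the summands. -/
noncomputable def lift (f : ∀ i, E i →L[𝕜] G) : LCDirectSum 𝕜 E →L[𝕜] G where
  toLinearMap := (DFinsupp.lsum ℕ fun i ↦ (f i : E i →ₗ[𝕜] G) : (Π₀ i, E i) →ₗ[𝕜] G)
  cont := continuous_of_comp_incl (E := E) fun i ↦
    (f i).continuous.congr fun b ↦
      (DFinsupp.lsum_single ℕ (fun i ↦ (f i : E i →ₗ[𝕜] G)) i b).symm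

@[simp]
theorem lift_incl (f : ∀ i, E i →L[𝕜] G) (i : ι) (b : E i) :
    lift f (incl 𝕜 E i b) = f i b := by
  classical
  exact DFinsupp.lsum_single ℕ (fun i ↦ (f i : E i →ₗ[𝕜] G)) i b

section Map

variable {E' E'' : ι → Type*} [∀ i, AddCommGroup (E' i)] [∀ i, Module 𝕜 (E' i)]
  [∀ i, TopologicalSpace (E' i)] [∀ i, AddCommGroup (E'' i)] [∀ i, Module 𝕜 (E'' i)]
  [∀ i, TopologicalSpace (E'' i)]

/-- The direct sum of a family of continuous linear maps. -/
noncomputable def map (g : ∀ i, E i →L[𝕜] E' i) : LCDirectSum 𝕜 E →L[𝕜] LCDirectSum 𝕜 E' :=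
  lift fun i ↦ (inclL 𝕜 E' i).comp (g i)

@[simp]
theorem map_incl (g : ∀ i, E i →L[𝕜] E' i) (i : ι) (b : E i) :
    map g (incl 𝕜 E i b) = incl 𝕜 E' i (g i b) :=
  lift_incl ..

theorem map_comp (h : ∀ i, E' i →L[𝕜] E'' i) (g : ∀ i, E i →L[𝕜] E' i) :
    (map h).comp (map g) = map fun i ↦ (h i).comp (g i) :=
  continuousLinearMap_ext fun i b ↦ by simp

theorem map_id : map (fun i ↦ .id 𝕜 (E i)) = .id 𝕜 (LCDirectSum 𝕜 E) :=
  continuousLinearMap_ext fun i b ↦ by simp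

end Map

variable [∀ i, IsTopologicalAddGroup (E i)] [∀ i, ContinuousSMul 𝕜 (E i)]
  [∀ i, LocallyConvexSpace 𝕜 (E i)]

theorem continuous_proj (i : ι) : Continuous (proj 𝕜 E i) := by
  refine continuous_of_comp_incl fun k ↦ ?_
  obtain rfl | h := eq_or_ne i k
  · exact continuous_id.congr fun b ↦ (proj_incl_self (𝕜 := 𝕜) i b).symm
  · exact continuous_const.congr fun b ↦ (proj_incl_of_ne (𝕜 := 𝕜) h b).symm

variable (𝕜 E) in
/-- `LCDirectSum.proj` as a continuous linear map. -/
def projL (i : ι) : LCDirectSum 𝕜 E →L[𝕜] E i := ⟨proj 𝕜 E i, continuous_proj i⟩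

@[simp]
theorem projL_apply (i : ι) (x : LCDirectSum 𝕜 E) : projL 𝕜 E i x = proj 𝕜 E i x := rfl

instance [∀ i, T2Space (E i)] : T2Space (LCDirectSum 𝕜 E) :=
  T2Space.of_injective_continuous (f := fun x i ↦ proj 𝕜 E i x)
    (fun _ _ h ↦ ext (congrFun h)) (continuous_pi continuous_proj)

variable (𝕜 E) in
/-- A finite direct sum is the product of its summands. -/
noncomputable def piEquiv [Fintype ι] : LCDirectSum 𝕜 E ≃L[𝕜] ∀ i, E i :=
  .equivOfInverse (.pi (projL 𝕜 E)) (∑ i, (inclL 𝕜 E i).comp (.proj i))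
    (fun x ↦ by simpa using sum_incl_proj (s := Finset.univ) (x := x) (by simp))
    fun x ↦ funext fun i ↦ by
      simp only [FunLike.coe_sum, Finset.sum_apply, ContinuousLinearMap.comp_apply,
        ContinuousLinearMap.proj_apply, inclL_apply, ContinuousLinearMap.pi_apply, projL_apply,
        map_sum]
      rw [Finset.sum_eq_single i (fun k _ hk ↦ proj_incl_of_ne hk.symm _) (by simp),
        proj_incl_self]

end Topology

section Baire

variable {𝕜 : Type u} [RCLike 𝕜] {ι : Type v} {E : ι → Type w} [∀ i, AddCommGroup (E i)]
  [∀ i, Module 𝕜 (E i)] [∀ i, TopologicalSpace (E i)] [∀ i, IsTopologicalAddGroup (E i)]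
  [∀ i, ContinuousSMul 𝕜 (E i)] [∀ i, LocallyConvexSpace 𝕜 (E i)] [∀ i, T1Space (E i)]
  {G : Type*} [AddCommGroup G] [Module 𝕜 G] [TopologicalSpace G] [ContinuousAdd G]
  [ContinuousSMul 𝕜 G] [BaireSpace G]

theorem finite_setOf_exists_proj_ne_zero (g : G →L[𝕜] LCDirectSum 𝕜 E) :
    {i | ∃ b, proj 𝕜 E i (g b) ≠ 0}.Finite := by
  by_contra hinf
  let s := Set.Infinite.natEmbedding _ hinf
  let M : ℕ → Submodule 𝕜 G := fun n ↦ ⨅ k ≥ n, ((projL 𝕜 E (s k)).comp g).ker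
  have hM (n : ℕ) (b : G) : b ∈ M n ↔ ∀ k ≥ n, proj 𝕜 E (s k) (g b) = 0 := by
    simp [M, Submodule.mem_iInf]
  have hclosed (n : ℕ) : IsClosed (M n : Set G) := by
    simp only [M, Submodule.coe_iInf]
    exact isClosed_iInter fun k ↦ isClosed_iInter fun _ ↦
      ((projL 𝕜 E (s k)).comp g).isClosed_ker
  have hcover : ⋃ n, (M n : Set G) = Set.univ := by
    refine Set.eq_univ_of_forall fun b ↦ Set.mem_iUnion.2 ?_
    have hfin : {k | proj 𝕜 E (s k) (g b) ≠ 0}.Finite :=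
      (finite_setOf_proj_ne_zero (g b)).preimage (f := fun k ↦ (s k : ι))
        (Subtype.val_injective.comp s.injective).injOn
    obtain ⟨n, hn⟩ := hfin.bddAbove
    exact ⟨n + 1, (hM _ _).2 fun k hk ↦ not_not.1 fun h ↦ hk.not_gt (Nat.lt_succ_of_le (hn h))⟩
  obtain ⟨n, hn⟩ := nonempty_interior_of_iUnion_of_closed hclosed hcover
  have htop : M n = ⊤ := (M n).eq_top_of_nonempty_interior' hn
  obtain ⟨b, hb⟩ := (s n).2
  exact hb ((hM n b).1 (htop ▸ Submodule.mem_top) n le_rfl)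

end Baire

section Restriction

variable {𝕜 : Type u} [RCLike 𝕜] {ι : Type v} {E : ι → Type w} [∀ i, AddCommGroup (E i)]
  [∀ i, Module 𝕜 (E i)] [∀ i, TopologicalSpace (E i)] (S : Set ι)

variable (𝕜 E) in
/-- Extension by zero from a set of indices. -/
noncomputable def extend : LCDirectSum 𝕜 (fun i : S ↦ E i) →L[𝕜] LCDirectSum 𝕜 E :=
  lift fun i : S ↦ inclL 𝕜 E i

open Classical in
variable (𝕜 E) in
/-- Restriction to a set of indices. -/
noncomputable def restrict : LCDirectSum 𝕜 E →L[𝕜] LCDirectSum 𝕜 (fun i : S ↦ E i) :=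
  lift fun i : ι ↦ if h : i ∈ S then inclL 𝕜 (fun i : S ↦ E i) ⟨i, h⟩ else 0

@[simp]
theorem extend_incl (i : S) (b : E i) :
    extend 𝕜 E S (incl 𝕜 (fun i : S ↦ E i) i b) = incl 𝕜 E i b :=
  lift_incl ..

variable {S} in
theorem restrict_incl_of_mem {i : ι} (h : i ∈ S) (b : E i) :
    restrict 𝕜 E S (incl 𝕜 E i b) = incl 𝕜 (fun i : S ↦ E i) ⟨i, h⟩ b := by
  simp [restrict, h]

variable {S} in
theorem restrict_incl_of_notMem {i : ι} (h : i ∉ S) (b : E i) :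
    restrict 𝕜 E S (incl 𝕜 E i b) = 0 := by
  simp [restrict, h]

@[simp]
theorem restrict_extend (y : LCDirectSum 𝕜 (fun i : S ↦ E i)) :
    restrict 𝕜 E S (extend 𝕜 E S y) = y := by
  have : (restrict 𝕜 E S).comp (extend 𝕜 E S) = .id 𝕜 _ :=
    continuousLinearMap_ext fun i b ↦ by simp [restrict_incl_of_mem]
  exact DFunLike.congr_fun this y

theorem extend_mem_supportedOn (y : LCDirectSum 𝕜 (fun i : S ↦ E i)) :
    extend 𝕜 E S y ∈ supportedOn 𝕜 E S :=
  supportedOn_le_comap (g := (extend 𝕜 E S).toLinearMap) (S := Set.univ)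
    (fun i _ b ↦ by simpa using incl_mem_supportedOn i.2 b) (mem_supportedOn.2 (by simp))

variable {S}

theorem extend_restrict_of_mem_supportedOn {x : LCDirectSum 𝕜 E} (hx : x ∈ supportedOn 𝕜 E S) :
    extend 𝕜 E S (restrict 𝕜 E S x) = x :=
  supportedOn_le_comap (M := LinearMap.eqLocus (extend 𝕜 E S ∘L restrict 𝕜 E S).toLinearMap .id)
    (g := .id) (fun i hi b ↦ by simp [restrict_incl_of_mem hi]) hx

theorem restrict_eq_zero_of_mem_supportedOn_compl {x : LCDirectSum 𝕜 E}
    (hx : x ∈ supportedOn 𝕜 E Sᶜ) : restrict 𝕜 E S x = 0 :=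
  supportedOn_le_comap (g := (restrict 𝕜 E S).toLinearMap) (M := ⊥)
    (fun _ hi b ↦ restrict_incl_of_notMem hi b) hx

end Restriction

section MatrixSupport

variable {𝕜 : Type u} [RCLike 𝕜] {ι : Type v} {E : ι → Type w} [∀ i, AddCommGroup (E i)]
  [∀ i, Module 𝕜 (E i)] [∀ i, TopologicalSpace (E i)]
  {P Q : LCDirectSum 𝕜 E →L[𝕜] LCDirectSum 𝕜 E} {r s t : ι → ι → Prop}

/-- An operator `P` on a direct sum is regarded as a matrix whose entry in row `k` and column `i`
is a map `E i → E k`. It has matrix support in `r` if all entries with `¬ r k i` vanish; for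
instance, `P` is block triangular with respect to `f : ι → J` if it has matrix support in
`fun k i ↦ f k ≤ f i`. -/
def HasMatrixSupport (r : ι → ι → Prop) (P : LCDirectSum 𝕜 E →L[𝕜] LCDirectSum 𝕜 E) : Prop :=
  ∀ i b, P (incl 𝕜 E i b) ∈ supportedOn 𝕜 E {k | r k i}

namespace HasMatrixSupport

theorem one (h : ∀ i, r i i) : HasMatrixSupport r (1 : LCDirectSum 𝕜 E →L[𝕜] LCDirectSum 𝕜 E) :=
  fun i ↦ incl_mem_supportedOn (S := {k | r k i}) (h i)

theorem sub (hP : HasMatrixSupport r P) (hQ : HasMatrixSupport r Q) : HasMatrixSupport r (P - Q) :=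
  fun i b ↦ Submodule.sub_mem _ (hP i b) (hQ i b)

theorem apply_mem_supportedOn (hP : HasMatrixSupport r P) {S S' : Set ι}
    (h : ∀ k, ∀ i ∈ S, r k i → k ∈ S') {x : LCDirectSum 𝕜 E} (hx : x ∈ supportedOn 𝕜 E S) :
    P x ∈ supportedOn 𝕜 E S' :=
  supportedOn_le_comap (g := P.toLinearMap)
    (fun i hi b ↦ supportedOn_mono (fun k hk ↦ h k i hi hk) (hP i b)) hx

theorem mul (hP : HasMatrixSupport r P) (hQ : HasMatrixSupport s Q)
    (h : ∀ k l i, r k l → s l i → t k i) : HasMatrixSupport t (P * Q) :=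
  fun i b ↦ hP.apply_mem_supportedOn (fun k l hl hk ↦ h k l i hk hl) (hQ i b)

end HasMatrixSupport

end MatrixSupport

section StrictlyTriangular

variable {𝕜 : Type u} [RCLike 𝕜] {ι : Type v} {E : ι → Type w} [∀ i, AddCommGroup (E i)]
  [∀ i, Module 𝕜 (E i)] [∀ i, TopologicalSpace (E i)] {J : Type*} [Preorder J] {f : ι → J}
  {N : LCDirectSum 𝕜 E →L[𝕜] LCDirectSum 𝕜 E}

theorem HasMatrixSupport.eq_zero_of_apply_eq_self (hN : HasMatrixSupport (fun k i ↦ f k < f i) N)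
    {x : LCDirectSum 𝕜 E} (hx : N x = x) : x = 0 := by
  obtain ⟨s, hs, hsum⟩ := exists_sum_incl_proj x
  obtain rfl | hne := s.eq_empty_or_nonempty
  · rw [← hsum, Finset.sum_empty]
  obtain ⟨i, hi, hmax⟩ := s.exists_maximalFor f hne
  have hxs : x ∈ supportedOn 𝕜 E s := by
    rw [← hsum]
    exact Submodule.sum_mem _ fun k hk ↦ incl_mem_supportedOn hk _
  have hNx : N x ∈ supportedOn 𝕜 E {i}ᶜ := hN.apply_mem_supportedOn (by
    rintro k l hl hlt rfl
    exact hlt.not_ge (hmax hl hlt.le)) hxs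
  rw [hx] at hNx
  exact absurd (mem_supportedOn.1 hNx i fun h ↦ h rfl) (hs i hi)

variable [WellFoundedLT J]

theorem HasMatrixSupport.exists_sub_apply_eq_incl
    (hN : HasMatrixSupport (fun k i ↦ f k < f i) N) (i : ι) :
    ∃ I : E i →L[𝕜] LCDirectSum 𝕜 E, ∀ b, I b - N (I b) = incl 𝕜 E i b := by
  classical
  induction i using (InvImage.wf f wellFounded_lt).induction with
  | _ i ih =>
  -- `(1 - N)⁻¹ = 1 + (1 - N)⁻¹ N`, and `N` maps the summand `E i` into the earlier ones, on which
  -- `R` is the inverse of `1 - N`.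
  choose! I hI using ih
  let R : LCDirectSum 𝕜 E →L[𝕜] LCDirectSum 𝕜 E := lift fun k ↦ if f k < f i then I k else 0
  have hR {y : LCDirectSum 𝕜 E} (hy : y ∈ supportedOn 𝕜 E {k | f k < f i}) :
      R y - N (R y) = y :=
    supportedOn_le_comap (M := LinearMap.eqLocus (R - N ∘L R).toLinearMap .id) (g := .id)
      (fun k (hk : f k < f i) b ↦ by simp [R, hk, hI k hk b]) hy
  refine ⟨inclL 𝕜 E i + R.comp (N.comp (inclL 𝕜 E i)), fun b ↦ ?_⟩
  calc incl 𝕜 E i b + R (N (incl 𝕜 E i b)) - N (incl 𝕜 E i b + R (N (incl 𝕜 E i b)))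
      = incl 𝕜 E i b - N (incl 𝕜 E i b) +
          (R (N (incl 𝕜 E i b)) - N (R (N (incl 𝕜 E i b)))) := by rw [map_add]; abel
    _ = incl 𝕜 E i b := by rw [hR (hN i b), sub_add_cancel]

theorem HasMatrixSupport.isUnit_one_sub (hN : HasMatrixSupport (fun k i ↦ f k < f i) N) :
    IsUnit (1 - N) := by
  choose I hI using hN.exists_sub_apply_eq_incl
  have hright : (1 - N) * lift I = 1 := continuousLinearMap_ext fun i b ↦ by simpa using hI i b
  refine isUnit_iff_exists.2 ⟨lift I, hright, sub_eq_zero.1 (ContinuousLinearMap.ext fun x ↦ ?_)⟩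
  have hx : (1 - N) ((lift I * (1 - N) - 1) x) = 0 := by
    have : (1 - N) * (lift I * (1 - N) - 1) = 0 := by
      rw [mul_sub, ← mul_assoc, hright, one_mul, mul_one, sub_self]
    exact DFunLike.congr_fun this x
  exact hN.eq_zero_of_apply_eq_self (sub_eq_zero.1 hx).symm

end StrictlyTriangular

section Fibers

variable {𝕜 : Type u} [RCLike 𝕜] {ι : Type v} {E : ι → Type w} [∀ i, AddCommGroup (E i)]
  [∀ i, Module 𝕜 (E i)] [∀ i, TopologicalSpace (E i)] {J : Type*} (f : ι → J)

variable (𝕜 E) in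
/-- The subsum over a fiber of a map `f` of the index set. -/
abbrev FiberSum (j : J) : Type (max v w) := LCDirectSum 𝕜 fun i : f ⁻¹' {j} ↦ E i

variable (𝕜 E) in
/-- Associativity of direct sums: a direct sum is the direct sum of its subsums over the fibers of
a map of the index set. -/
noncomputable def fiberEquiv : LCDirectSum 𝕜 E ≃L[𝕜] LCDirectSum 𝕜 (FiberSum 𝕜 E f) :=
  let g : LCDirectSum 𝕜 E →L[𝕜] LCDirectSum 𝕜 (FiberSum 𝕜 E f) := lift fun i ↦
    (inclL 𝕜 (FiberSum 𝕜 E f) (f i)).comp (inclL 𝕜 (fun k : f ⁻¹' {f i} ↦ E k) ⟨i, rfl⟩)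
  let h : LCDirectSum 𝕜 (FiberSum 𝕜 E f) →L[𝕜] LCDirectSum 𝕜 E :=
    lift fun j ↦ extend 𝕜 E (f ⁻¹' {j})
  haveI hg (j : J) : g.comp (extend 𝕜 E (f ⁻¹' {j})) = inclL 𝕜 (FiberSum 𝕜 E f) j :=
    continuousLinearMap_ext fun ⟨i, hi⟩ b ↦ by
      obtain rfl : f i = j := hi
      simp [g]
  haveI hhg : h.comp g = .id 𝕜 _ := continuousLinearMap_ext fun i b ↦ by simp [g, h]
  haveI hgh : g.comp h = .id 𝕜 _ := continuousLinearMap_ext fun j y ↦ by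
    simpa [h] using DFunLike.congr_fun (hg j) y
  .equivOfInverse g h (fun x ↦ DFunLike.congr_fun hhg x) fun y ↦ DFunLike.congr_fun hgh y

@[simp]
theorem fiberEquiv_incl (i : ι) (b : E i) :
    fiberEquiv 𝕜 E f (incl 𝕜 E i b) =
      incl 𝕜 (FiberSum 𝕜 E f) (f i) (incl 𝕜 (fun k : f ⁻¹' {f i} ↦ E k) ⟨i, rfl⟩ b) :=
  lift_incl ..

@[simp]
theorem fiberEquiv_symm_incl (j : J) (y : FiberSum 𝕜 E f j) :
    (fiberEquiv 𝕜 E f).symm (incl 𝕜 (FiberSum 𝕜 E f) j y) = extend 𝕜 E (f ⁻¹' {j}) y :=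
  lift_incl ..

end Fibers

section Blocks

variable {𝕜 : Type u} [RCLike 𝕜] {ι : Type v} {E : ι → Type w} [∀ i, AddCommGroup (E i)]
  [∀ i, Module 𝕜 (E i)] [∀ i, TopologicalSpace (E i)]

/-- The diagonal block of an operator on a direct sum that belongs to a set of indices. -/
noncomputable def block (P : LCDirectSum 𝕜 E →L[𝕜] LCDirectSum 𝕜 E) (S : Set ι) :
    LCDirectSum 𝕜 (fun i : S ↦ E i) →L[𝕜] LCDirectSum 𝕜 (fun i : S ↦ E i) :=
  (restrict 𝕜 E S).comp (P.comp (extend 𝕜 E S))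

theorem block_apply (P : LCDirectSum 𝕜 E →L[𝕜] LCDirectSum 𝕜 E) (S : Set ι)
    (y : LCDirectSum 𝕜 (fun i : S ↦ E i)) :
    block P S y = restrict 𝕜 E S (P (extend 𝕜 E S y)) := rfl

/-- The block diagonal part of an operator on a direct sum, the blocks being indexed by the fibers
of `f`. -/
noncomputable def blockDiagonal {J : Type*} (f : ι → J)
    (P : LCDirectSum 𝕜 E →L[𝕜] LCDirectSum 𝕜 E) : LCDirectSum 𝕜 E →L[𝕜] LCDirectSum 𝕜 E :=
  ((fiberEquiv 𝕜 E f).symm : _ →L[𝕜] LCDirectSum 𝕜 E).comp <|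
    (map fun j ↦ block P (f ⁻¹' {j})).comp (fiberEquiv 𝕜 E f : LCDirectSum 𝕜 E →L[𝕜] _)

theorem blockDiagonal_incl {J : Type*} (f : ι → J) (P : LCDirectSum 𝕜 E →L[𝕜] LCDirectSum 𝕜 E)
    (i : ι) (b : E i) : blockDiagonal f P (incl 𝕜 E i b) =
      extend 𝕜 E (f ⁻¹' {f i}) (restrict 𝕜 E (f ⁻¹' {f i}) (P (incl 𝕜 E i b))) := by
  simp [blockDiagonal, block_apply]

variable {J : Type*} [PartialOrder J] {f : ι → J} {P Q : LCDirectSum 𝕜 E →L[𝕜] LCDirectSum 𝕜 E}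

theorem sub_extend_restrict_fiber_mem_supportedOn {j : J} {x : LCDirectSum 𝕜 E}
    (hx : x ∈ supportedOn 𝕜 E {k | f k ≤ j}) :
    x - extend 𝕜 E (f ⁻¹' {j}) (restrict 𝕜 E (f ⁻¹' {j}) x) ∈ supportedOn 𝕜 E {k | f k < j} := by
  refine supportedOn_le_comap (M := supportedOn 𝕜 E {k | f k < j})
    (g := .id - ((extend 𝕜 E (f ⁻¹' {j})).comp (restrict 𝕜 E (f ⁻¹' {j}))).toLinearMap)
    (fun i (hi : f i ≤ j) b ↦ ?_) hx
  obtain hlt | heq := hi.lt_or_eq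
  · simpa [restrict_incl_of_notMem (S := f ⁻¹' {j}) hlt.ne] using
      incl_mem_supportedOn (S := {k | f k < j}) hlt b
  · simp [restrict_incl_of_mem (S := f ⁻¹' {j}) heq]

theorem block_mul (hP : HasMatrixSupport (fun k i ↦ f k ≤ f i) P)
    (hQ : HasMatrixSupport (fun k i ↦ f k ≤ f i) Q) (j : J) :
    block (P * Q) (f ⁻¹' {j}) = block P (f ⁻¹' {j}) * block Q (f ⁻¹' {j}) := by
  ext1 y
  set x := Q (extend 𝕜 E (f ⁻¹' {j}) y)
  have hx : x ∈ supportedOn 𝕜 E {k | f k ≤ j} :=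
    hQ.apply_mem_supportedOn (fun k i hi hk ↦ hk.trans_eq hi) (extend_mem_supportedOn _ y)
  have hPx : P (x - extend 𝕜 E _ (restrict 𝕜 E (f ⁻¹' {j}) x)) ∈ supportedOn 𝕜 E (f ⁻¹' {j})ᶜ :=
    hP.apply_mem_supportedOn (fun k i hi hk ↦ (hk.trans_lt hi).ne)
      (sub_extend_restrict_fiber_mem_supportedOn hx)
  have := restrict_eq_zero_of_mem_supportedOn_compl hPx
  rwa [map_sub, map_sub, sub_eq_zero] at this

theorem isIdempotentElem_block (hP : HasMatrixSupport (fun k i ↦ f k ≤ f i) P)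
    (hidem : IsIdempotentElem P) (j : J) : IsIdempotentElem (block P (f ⁻¹' {j})) := by
  rw [IsIdempotentElem, ← block_mul hP hP, hidem]

theorem hasMatrixSupport_sub_blockDiagonal (hP : HasMatrixSupport (fun k i ↦ f k ≤ f i) P) :
    HasMatrixSupport (fun k i ↦ f k < f i) (P - blockDiagonal f P) := fun i b ↦ by
  rw [sub_apply, blockDiagonal_incl]
  exact sub_extend_restrict_fiber_mem_supportedOn (hP i b)

variable [WellFoundedLT J]

theorem isUnit_mul_blockDiagonal_add (hP : HasMatrixSupport (fun k i ↦ f k ≤ f i) P)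
    (hidem : IsIdempotentElem P) :
    IsUnit (P * blockDiagonal f P + (1 - P) * (1 - blockDiagonal f P)) := by
  have h1 : HasMatrixSupport (fun k i ↦ f k ≤ f i) (1 : LCDirectSum 𝕜 E →L[𝕜] LCDirectSum 𝕜 E) :=
    .one fun i ↦ le_refl (f i)
  have hL := hasMatrixSupport_sub_blockDiagonal hP
  rw [mul_add_one_sub_mul_one_sub hidem]
  exact HasMatrixSupport.isUnit_one_sub <| (hP.mul hL fun _ _ _ ↦ lt_of_le_of_lt).sub
    ((h1.sub hP).mul hL fun _ _ _ ↦ lt_of_le_of_lt)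

theorem nonempty_range_equiv_range_block (hP : HasMatrixSupport (fun k i ↦ f k ≤ f i) P)
    (hidem : IsIdempotentElem P) :
    Nonempty (P.range ≃L[𝕜] LCDirectSum 𝕜 fun j ↦ (block P (f ⁻¹' {j})).range) := by
  let e := fiberEquiv 𝕜 E f
  let ρ := map fun j ↦ (block P (f ⁻¹' {j})).rangeRestrict
  let σ := map fun j ↦ (block P (f ⁻¹' {j})).range.subtypeL
  have hρσ : ρ.comp σ = .id 𝕜 _ := by
    simp only [ρ, σ, map_comp, rangeRestrict_comp_subtypeL (isIdempotentElem_block hP hidem _),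
      map_id]
  have hσρ : σ.comp ρ = map fun j ↦ block P (f ⁻¹' {j}) := map_comp _ _
  let j := (e.symm : _ →L[𝕜] LCDirectSum 𝕜 E).comp σ
  let q := ρ.comp (e : LCDirectSum 𝕜 E →L[𝕜] _)
  have hqj : q.comp j = .id 𝕜 _ := by
    ext1 y
    simpa [q, j] using congr($hρσ y)
  have hjq : j.comp q = blockDiagonal f P := by
    rw [blockDiagonal, ← hσρ]
    rfl
  refine nonempty_continuousLinearEquiv_of_isUnit (i := P.range.subtypeL) (p := P.rangeRestrict)
    (rangeRestrict_comp_subtypeL hidem) hqj ?_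
  rw [hjq]
  exact isUnit_mul_blockDiagonal_add hP hidem

end Blocks

section FiniteSection

variable {𝕜 : Type u} [RCLike 𝕜] {ι : Type v} {E : ι → Type w} [∀ i, AddCommGroup (E i)]
  [∀ i, Module 𝕜 (E i)] [∀ i, TopologicalSpace (E i)] [∀ i, IsTopologicalAddGroup (E i)]
  [∀ i, ContinuousSMul 𝕜 (E i)] [∀ i, LocallyConvexSpace 𝕜 (E i)]
  (F : Submodule 𝕜 (LCDirectSum 𝕜 E)) (A : Set ι) [Fintype A]

variable (𝕜 E) in
/-- The embedding of a finite product of summands into the direct sum. -/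
noncomputable def ofPi : (∀ i : A, E i) →L[𝕜] LCDirectSum 𝕜 E :=
  (extend 𝕜 E A).comp ((piEquiv 𝕜 fun i : A ↦ E i).symm : _ →L[𝕜] _)

variable (𝕜 E) in
/-- The projection of the direct sum onto a finite product of summands. -/
noncomputable def toPi : LCDirectSum 𝕜 E →L[𝕜] ∀ i : A, E i :=
  (piEquiv 𝕜 fun i : A ↦ E i : _ →L[𝕜] _).comp (restrict 𝕜 E A)

theorem toPi_ofPi (x : ∀ i : A, E i) : toPi 𝕜 E A (ofPi 𝕜 E A x) = x := by
  simp [toPi, ofPi]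

theorem ofPi_mem_supportedOn (x : ∀ i : A, E i) : ofPi 𝕜 E A x ∈ supportedOn 𝕜 E A :=
  extend_mem_supportedOn A _

variable {A} in
theorem ofPi_toPi {x : LCDirectSum 𝕜 E} (hx : x ∈ supportedOn 𝕜 E A) :
    ofPi 𝕜 E A (toPi 𝕜 E A x) = x := by
  simp [toPi, ofPi, extend_restrict_of_mem_supportedOn hx]

/-- The members of a subspace `F` of a direct sum that are supported on a finite set `A` of
indices, regarded as a subspace of the product of the summands in order to inherit its norm. -/
noncomputable def finiteSection : Submodule 𝕜 (∀ i : A, E i) :=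
  F.comap (ofPi 𝕜 E A : (∀ i : A, E i) →ₗ[𝕜] LCDirectSum 𝕜 E)

/-- The inclusion of a finite section in the subspace. -/
noncomputable def finiteSectionIncl : finiteSection F A →L[𝕜] F :=
  ((ofPi 𝕜 E A).comp (finiteSection F A).subtypeL).codRestrict F fun x ↦ x.2

theorem isEmbedding_finiteSectionIncl : IsEmbedding (finiteSectionIncl F A) := by
  refine .of_comp (g := fun y : F ↦ toPi 𝕜 E A (y : LCDirectSum 𝕜 E))
    (finiteSectionIncl F A).continuous (by fun_prop) ?_
  have : (fun y : F ↦ toPi 𝕜 E A (y : LCDirectSum 𝕜 E)) ∘ finiteSectionIncl F A = Subtype.val :=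
    funext fun x ↦ toPi_ofPi A x.1
  exact this ▸ .subtypeVal

variable {F A} in
theorem mem_range_finiteSectionIncl {y : F} :
    y ∈ (finiteSectionIncl F A).range ↔ (y : LCDirectSum 𝕜 E) ∈ supportedOn 𝕜 E A := by
  constructor
  · rintro ⟨x, rfl⟩
    exact ofPi_mem_supportedOn A x.1
  · intro hy
    have hmem : toPi 𝕜 E A (y : LCDirectSum 𝕜 E) ∈ finiteSection F A := by
      simp only [finiteSection, Submodule.mem_comap, ContinuousLinearMap.coe_coe, ofPi_toPi hy,
        SetLike.coe_mem]
    exact ⟨⟨_, hmem⟩, Subtype.ext (ofPi_toPi hy)⟩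

variable {F} in
theorem isClosed_finiteSection (hF : IsClosed (F : Set (LCDirectSum 𝕜 E))) :
    IsClosed (finiteSection F A : Set (∀ i : A, E i)) :=
  hF.preimage (ofPi 𝕜 E A).continuous

end FiniteSection

section Countable

variable {𝕜 : Type u} [RCLike 𝕜] {ι : Type v} [Countable ι] {E : ι → Type w}
  [∀ i, NormedAddCommGroup (E i)] [∀ i, NormedSpace 𝕜 (E i)] [∀ i, CompleteSpace (E i)]

theorem isLBSpace_of_closedComplemented {F : Submodule 𝕜 (LCDirectSum 𝕜 E)}
    (hF : F.ClosedComplemented) : IsLBSpace 𝕜 F := by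
  obtain ⟨A, hA_mono, hA⟩ := Filter.exists_seq_monotone_tendsto_atTop_atTop (Finset ι)
  have hexhaust {s : Set ι} (hs : s.Finite) : ∃ n, s ⊆ A n := by
    obtain ⟨n, hn⟩ := (hA.eventually_ge_atTop hs.toFinset).exists
    exact ⟨n, hs.toFinset_subset.1 hn⟩
  have hcomplete (n : ℕ) : CompleteSpace (finiteSection F (A n : Set ι)) :=
    (isClosed_finiteSection _ hF.isClosed).completeSpace_coe
  have hemb (n : ℕ) := isEmbedding_finiteSectionIncl F (A n : Set ι)
  refine isLBSpace_of_isEmbedding hemb (fun m n hmn y hy ↦ ?_) (fun y ↦ ?_) (le_antisymm ?_ ?_)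
  · rw [mem_range_finiteSectionIncl] at hy ⊢
    exact supportedOn_mono (Finset.coe_subset.2 (hA_mono hmn)) hy
  · obtain ⟨n, hn⟩ := hexhaust (finite_setOf_proj_ne_zero (y : LCDirectSum 𝕜 E))
    exact ⟨n, mem_range_finiteSectionIncl.2 (mem_supportedOn_iff_setOf_subset.2 hn)⟩
  · obtain ⟨p, hp⟩ := hF
    refine (eq_finestLocallyConvexTopology_of_retract p F.subtypeL hp).le.trans <|
      finestLocallyConvexTopology_le_of_factor fun k ↦ ?_
    obtain ⟨n, hn⟩ := hexhaust <|
      finite_setOf_exists_proj_ne_zero (F.subtypeL.comp (p.comp (inclL 𝕜 E k)))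
    refine ⟨n, exists_continuousLinearMap_comp_eq (hemb n) (g := p.comp (inclL 𝕜 E k))
      fun b ↦ mem_range_finiteSectionIncl.2 ?_⟩
    exact mem_supportedOn_iff_setOf_subset.2 fun i hi ↦ hn ⟨b, hi⟩
  · exact finestLocallyConvexTopology_le fun n ↦ (finiteSectionIncl F _).continuous

end Countable

end LCDirectSum

open LCDirectSum in
theorem theoremT_general {𝕜 : Type w} [RCLike 𝕜] {T : Type u} [Infinite T] (B : T → Type v)
    [∀ t, NormedAddCommGroup (B t)] [∀ t, NormedSpace 𝕜 (B t)] [∀ t, CompleteSpace (B t)]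
    (X : Submodule 𝕜 (LCDirectSum 𝕜 B)) (hX : X.ClosedComplemented) :
    ∃ (J : Type u) (S : J → Set T)
      (F : ∀ j, Submodule 𝕜 (LCDirectSum 𝕜 (fun t : S j ↦ B t))),
      (∀ j, Cardinal.mk (S j) = Cardinal.aleph0) ∧
      (∀ j, (F j).ClosedComplemented) ∧
      (∀ j, IsLBSpace 𝕜 (F j)) ∧
      Nonempty (X ≃L[𝕜] LCDirectSum 𝕜 (fun j ↦ F j)) := by
  obtain ⟨P, hidem, rfl⟩ := closedComplemented_iff_exists_isIdempotentElem.1 hX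
  obtain ⟨J, _, _, f, hf, hcard⟩ := exists_wellFounded_partition
    (r := fun t s ↦ ∃ b, proj 𝕜 B s (P (incl 𝕜 B t b)) ≠ 0) fun t ↦
      (finite_setOf_exists_proj_ne_zero (P.comp (inclL 𝕜 B t))).countable
  have hP : HasMatrixSupport (fun s t ↦ f s ≤ f t) P := fun t b ↦
    mem_supportedOn_iff_setOf_subset.2 fun s hs ↦ hf t s ⟨b, hs⟩
  have hF (j : J) : (block P (f ⁻¹' {j})).range.ClosedComplemented :=
    closedComplemented_iff_exists_isIdempotentElem.2 ⟨_, isIdempotentElem_block hP hidem j, rfl⟩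
  have hcountable (j : J) : Countable (f ⁻¹' {j}) := Cardinal.mk_le_aleph0_iff.1 (hcard j).le
  exact ⟨J, fun j ↦ f ⁻¹' {j}, fun j ↦ (block P (f ⁻¹' {j})).range, hcard, hF,
    fun j ↦ isLBSpace_of_closedComplemented (hF j), nonempty_range_equiv_range_block hP hidem⟩

theorem theoremT {𝕜 : Type w} [RCLike 𝕜] {T : Type u} [Uncountable T] (B : T → Type v)
    [∀ t, NormedAddCommGroup (B t)] [∀ t, NormedSpace 𝕜 (B t)] [∀ t, CompleteSpace (B t)]
    (X : Submodule 𝕜 (LCDirectSum 𝕜 B)) (hX : X.ClosedComplemented) :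
    ∃ (J : Type u) (S : J → Set T)
      (F : ∀ j, Submodule 𝕜 (LCDirectSum 𝕜 (fun t : S j ↦ B t))),
      (∀ j, Cardinal.mk (S j) = Cardinal.aleph0) ∧
      (∀ j, (F j).ClosedComplemented) ∧
      (∀ j, IsLBSpace 𝕜 (F j)) ∧
      Nonempty (X ≃L[𝕜] LCDirectSum 𝕜 (fun j ↦ F j)) :=
  theoremT_general B X hX
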